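/- For $n\ge 1$ let $\Delta_n\subset\mathbb{R}^n$ be a regular $n$-simplex inscribed in the Euclidean unit ball $B_2^n$ (all its vertices lie on the unit sphere), and let $$M^{(2)}_n=\operatorname{conv}\Bigl((\Delta_n\times\{0\})\cup\bigl(\tfrac1n B_2^n\times\{1\}\bigr)\Bigr)\subset\mathbb{R}^{n}\times\mathbb{R}=\mathbb{R}^{n+1},\qquad e_{n+1}=(0,\dots,0,1).$$ Then $M^{(2)}_n$ has a unique John ellipsoid (ellipsoid of maximal volume contained in it) and a unique Löwner ellipsoid (ellipsoid of minimal volume containing it), and their centres $j(M^{(2)}_n)$ and $l(M^{(2)}_n)$ satisfy, for every $n\ge1$, $$j(M^{(2)}_n)=\tfrac12 e_{n+1}\qquad\text{and}\qquad l(M^{(2)}_n)=l_n\,e_{n+1},$$ where the real numbers $l_n$ do not depend on the choice of the regular simplex $\Delta_n$ and $l_n=\frac1n+o\left(\frac1n\right)$ as $n\to\infty$. -/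

import Mathlib

open MeasureTheory Filter Asymptotics

/-- `E` is a (full-dimensional, solid) ellipsoid with centre `p`: the image of the closed unit
ball under an invertible linear map, translated by `p`. -/
def IsEllipsoidWithCenter {m : ℕ} (E : Set (EuclideanSpace ℝ (Fin m)))
    (p : EuclideanSpace ℝ (Fin m)) : Prop :=
  ∃ T : EuclideanSpace ℝ (Fin m) ≃L[ℝ] EuclideanSpace ℝ (Fin m),
    E = (fun x => p + T x) '' Metric.closedBall 0 1

/-- `E` is an ellipsoid. -/
def IsEllipsoid {m : ℕ} (E : Set (EuclideanSpace ℝ (Fin m))) : Prop :=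
  ∃ p, IsEllipsoidWithCenter E p

/-- `J` is a John ellipsoid of `K`: an ellipsoid of maximal volume among those inside `K`. -/
def IsJohnEllipsoid {m : ℕ} (K J : Set (EuclideanSpace ℝ (Fin m))) : Prop :=
  IsEllipsoid J ∧ J ⊆ K ∧ ∀ E, IsEllipsoid E → E ⊆ K → volume E ≤ volume J

/-- `L` is a Löwner ellipsoid of `K`: an ellipsoid of minimal volume among those containing `K`. -/
def IsLownerEllipsoid {m : ℕ} (K L : Set (EuclideanSpace ℝ (Fin m))) : Prop :=
  IsEllipsoid L ∧ K ⊆ L ∧ ∀ E, IsEllipsoid E → K ⊆ E → volume L ≤ volume E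

/-- `p` is the centre of a John ellipsoid of `K`. -/
def IsJohnCenter {m : ℕ} (K : Set (EuclideanSpace ℝ (Fin m)))
    (p : EuclideanSpace ℝ (Fin m)) : Prop :=
  ∃ J, IsJohnEllipsoid K J ∧ IsEllipsoidWithCenter J p

/-- `p` is the centre of a Löwner ellipsoid of `K`. -/
def IsLownerCenter {m : ℕ} (K : Set (EuclideanSpace ℝ (Fin m)))
    (p : EuclideanSpace ℝ (Fin m)) : Prop :=
  ∃ L, IsLownerEllipsoid K L ∧ IsEllipsoidWithCenter L p

/-- The point `(x, t)` of `ℝⁿ × ℝ = ℝⁿ⁺¹`. -/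
def atHeight {n : ℕ} (t : ℝ) (x : EuclideanSpace ℝ (Fin n)) : EuclideanSpace ℝ (Fin (n + 1)) :=
  WithLp.toLp 2 (Fin.snoc (α := fun _ => ℝ) (fun i => x i) t)

/-- The simplex `S` is regular and inscribed into the Euclidean unit ball: all its edges have the
same length and all its vertices lie on the unit sphere. -/
def IsInscribedRegularSimplex {n : ℕ}
    (S : Affine.Simplex ℝ (EuclideanSpace ℝ (Fin n)) n) : Prop :=
  S.Equilateral ∧ ∀ i, ‖S.points i‖ = 1

/-- The body `conv((Δ, 0), ((1/n) B₂ⁿ, 1))` in `ℝⁿ⁺¹`, where `Δ` is the solid simplex `S`. -/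
def bodyM2 {n : ℕ} (S : Affine.Simplex ℝ (EuclideanSpace ℝ (Fin n)) n) :
    Set (EuclideanSpace ℝ (Fin (n + 1))) :=
  convexHull ℝ (atHeight 0 '' convexHull ℝ (Set.range S.points) ∪
    atHeight 1 '' Metric.closedBall 0 (1 / (n : ℝ)))

/-- Inscribed regular simplices exist in every positive dimension. -/
theorem exists_isInscribedRegularSimplex (n : ℕ) (hn : 1 ≤ n) :
    ∃ S : Affine.Simplex ℝ (EuclideanSpace ℝ (Fin n)) n, IsInscribedRegularSimplex S := by
  classical
  have hn0 : (0 : ℝ) < n := by exact_mod_cast hn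
  let u : EuclideanSpace ℝ (Fin (n + 1)) := WithLp.toLp 2 (fun _ => (1 : ℝ))
  have hu : u ≠ 0 := by
    intro h
    have := congrArg (fun w : EuclideanSpace ℝ (Fin (n + 1)) => w 0) h
    simp [u] at this
  let e (i : Fin (n + 1)) : EuclideanSpace ℝ (Fin (n + 1)) := EuclideanSpace.single i 1
  have hee (i j) : inner ℝ (e i) (e j) = if i = j then (1 : ℝ) else 0 := by
    simp [e, PiLp.inner_apply, eq_comm]
  have heu (i) : inner ℝ (e i) u = (1 : ℝ) := by
    simp [e, u, PiLp.inner_apply]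
  have hue (i) : inner ℝ u (e i) = (1 : ℝ) := by rw [real_inner_comm, heu]
  have huu : inner ℝ u u = (n + 1 : ℝ) := by
    simp only [u, PiLp.inner_apply]
    simp
  have hn1 : (n + 1 : ℝ) ≠ 0 := by positivity
  let W := (Submodule.span ℝ {u})ᗮ
  have : Fact (Module.finrank ℝ (EuclideanSpace ℝ (Fin (n + 1))) = n + 1) :=
    ⟨by simp⟩
  have hW : Module.finrank ℝ W = n := Submodule.finrank_orthogonal_span_singleton hu
  let φ : W ≃ₗᵢ[ℝ] EuclideanSpace ℝ (Fin n) :=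
    ((stdOrthonormalBasis ℝ W).reindex (finCongr hW)).repr
  let w (i : Fin (n + 1)) : W := ⟨e i - (1 / (n + 1 : ℝ)) • u, by
    rw [Submodule.mem_orthogonal_singleton_iff_inner_right, inner_sub_right, inner_smul_right,
      huu, hue]
    field_simp
    ring⟩
  have hww (i j) : inner ℝ (w i) (w j) = (if i = j then (1 : ℝ) else 0) - 1 / (n + 1) := by
    simp only [w, Submodule.coe_inner, inner_sub_left, inner_sub_right, inner_smul_left,
      inner_smul_right, hee, heu, hue, huu]
    simp only [RCLike.conj_to_real]
    field_simp
    ring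
  let a : ℝ := √((n + 1) / n)
  have ha : a * a = (n + 1) / n := Real.mul_self_sqrt (by positivity)
  let v (i : Fin (n + 1)) : EuclideanSpace ℝ (Fin n) := φ (a • w i)
  have hvv (i j) : inner ℝ (v i) (v j) =
      (n + 1) / n * ((if i = j then (1 : ℝ) else 0) - 1 / (n + 1)) := by
    simp only [v, LinearIsometryEquiv.inner_map_map, inner_smul_left, inner_smul_right, hww]
    simp only [RCLike.conj_to_real]
    rw [← mul_assoc, ha]
  have hind : AffineIndependent ℝ v := by
    rw [affineIndependent_iff]
    intro s c hc hcv i hi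
    have h1 : inner ℝ (v i) (∑ j ∈ s, c j • v j) = 0 := by rw [hcv, inner_zero_right]
    simp only [inner_sum, inner_smul_right, hvv] at h1
    have h2 : ∑ j ∈ s, c j * ((n + 1) / n * ((if i = j then (1 : ℝ) else 0) - 1 / (n + 1))) =
        (n + 1) / n * c i - 1 / n * ∑ j ∈ s, c j := by
      have : ∀ j, c j * ((n + 1) / n * ((if i = j then (1 : ℝ) else 0) - 1 / (n + 1))) =
          (if i = j then (n + 1) / n * c j else 0) - 1 / n * c j := by
        intro j
        split_ifs <;> field_simp
        all_goals ring
      simp only [this, Finset.sum_sub_distrib, Finset.sum_ite_eq, hi, if_true, Finset.mul_sum]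
    rw [h2, hc, mul_zero, sub_zero] at h1
    exact (mul_eq_zero.mp h1).resolve_left (by positivity)
  have hnorm (i) : ‖v i‖ = 1 := by
    have h : ‖v i‖ * ‖v i‖ = 1 := by
      rw [← real_inner_self_eq_norm_mul_norm, hvv, if_pos rfl]
      field_simp
      ring
    nlinarith [norm_nonneg (v i)]
  refine ⟨⟨v, hind⟩, ⟨√(2 + 2 / n), ?_⟩, hnorm⟩
  intro i j hij
  rw [dist_eq_norm, eq_comm, Real.sqrt_eq_iff_mul_self_eq (by positivity) (norm_nonneg _)]
  rw [← real_inner_self_eq_norm_mul_norm]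
  simp only [inner_sub_left, inner_sub_right, hvv, if_true, if_neg hij, if_neg hij.symm]
  field_simp
  ring

/-! Both ellipsoids are found explicitly and certified by John's contact criterion: after an affine
change turning the candidate into the unit ball, unit vectors `u i` with positive weights satisfying
`∑ w u = 0` and `∑ w u ⊗ u = I` force optimality, uniqueness and the centre (`john_of_contact`,
`lowner_of_contact`). The core is a trace bound, tested at the `u i`, followed by the
arithmetic-geometric mean inequality for eigenvalues.

For the body, the vertices `v i` of the simplex satisfy `∑ v = 0` and `∑ v ⊗ v = ((n+1)/n) I`. The
John ellipsoid has horizontal semi-axes `1/n` and vertical semi-axis `1/2`: it lies in the cylinder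
over the inball, while the body lies in the prism `Δ × [0,1]`, whose facets it touches. The Löwner
ellipsoid touches the body at `(v i, 0)` and `(v i / n, 1)`. The decomposition conditions fix its
axes in terms of the height `l` of its centre, and contact becomes a quadratic equation for `l` with
coefficients in `x = 1/n`. Its root `lownerHeight x` is `x (1 + o(1))` as `x → 0`. -/

/-! ### Polar decomposition and the determinant-trace inequality. -/

open scoped MatrixOrder in
/-- Left polar decomposition, in the form of its effect on the unit ball. -/
theorem exists_posDef_image_closedBall_eq {m : ℕ}
    (T : EuclideanSpace ℝ (Fin m) ≃L[ℝ] EuclideanSpace ℝ (Fin m)) :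
    ∃ A : Matrix (Fin m) (Fin m) ℝ, A.PosDef ∧
      A.det = |LinearMap.det (T : EuclideanSpace ℝ (Fin m) →ₗ[ℝ] EuclideanSpace ℝ (Fin m))| ∧
      T '' Metric.closedBall 0 1 =
        Matrix.toEuclideanCLM (n := Fin m) (𝕜 := ℝ) A '' Metric.closedBall 0 1 := by
  let Φ := Matrix.toEuclideanCLM (n := Fin m) (𝕜 := ℝ)
  let M := Φ.symm (T : EuclideanSpace ℝ (Fin m) →L[ℝ] EuclideanSpace ℝ (Fin m))
  let N := Φ.symm (T.symm : EuclideanSpace ℝ (Fin m) →L[ℝ] EuclideanSpace ℝ (Fin m))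
  have hM : Φ M = T := Φ.apply_symm_apply _
  have hMN : M * N = 1 := by
    rw [← map_mul, ← map_one Φ.symm]
    congr 1
    ext1 x
    simp
  have hdet : M.det =
      LinearMap.det (T : EuclideanSpace ℝ (Fin m) →ₗ[ℝ] EuclideanSpace ℝ (Fin m)) := by
    have h1 : (T : EuclideanSpace ℝ (Fin m) →ₗ[ℝ] EuclideanSpace ℝ (Fin m)) =
        Matrix.toEuclideanLin M := by
      rw [← Matrix.coe_toEuclideanCLM_eq_toEuclideanLin]
      exact congrArg (fun f : EuclideanSpace ℝ (Fin m) →L[ℝ] EuclideanSpace ℝ (Fin m) =>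
        (f : EuclideanSpace ℝ (Fin m) →ₗ[ℝ] EuclideanSpace ℝ (Fin m))) hM.symm
    rw [h1, Matrix.toEuclideanLin, Matrix.toLpLin_eq_toLin, LinearMap.det_toLin]
  have hMu : IsUnit M := IsUnit.of_mul_eq_one N hMN
  have hPps : (M * M.conjTranspose).PosSemidef := Matrix.posSemidef_self_mul_conjTranspose M
  let A := CFC.sqrt (M * M.conjTranspose)
  have hAps : A.PosSemidef := Matrix.nonneg_iff_posSemidef.mp (CFC.sqrt_nonneg _)
  have hAA : A * A = M * M.conjTranspose := CFC.sqrt_mul_sqrt_self _ hPps.nonneg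
  have hdetA : A.det * A.det = M.det * M.det := by
    rw [← Matrix.det_mul, hAA, Matrix.det_mul, Matrix.det_conjTranspose]
    simp
  have hMd : M.det ≠ 0 := ((Matrix.isUnit_iff_isUnit_det _).mp hMu).ne_zero
  have hAd : A.det ≠ 0 := by
    intro h
    rw [h] at hdetA
    exact hMd (mul_self_eq_zero.mp (by rw [← hdetA]; simp))
  have hAu : IsUnit A := (Matrix.isUnit_iff_isUnit_det _).mpr (isUnit_iff_ne_zero.mpr hAd)
  have hA : A.PosDef := hAps.posDef_iff_isUnit.mpr hAu
  have hAu' : IsUnit A.det := isUnit_iff_ne_zero.mpr hAd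
  -- `U` is the orthogonal factor: `A * A = M * Mᵀ` gives `U * Uᵀ = 1`, so `U` maps the unit ball
  -- onto itself.
  let U := A⁻¹ * M
  have hAUM : A * U = M := by
    simp only [U, ← mul_assoc, Matrix.mul_nonsing_inv A hAu', one_mul]
  have hUU : U * star U = 1 := by
    have h : star U = M.conjTranspose * A⁻¹ := by
      rw [Matrix.star_eq_conjTranspose, Matrix.conjTranspose_mul, hA.inv.isHermitian.eq]
    rw [h, show A⁻¹ * M * (M.conjTranspose * A⁻¹) = A⁻¹ * (M * M.conjTranspose) * A⁻¹ by
      simp only [mul_assoc], ← hAA, ← mul_assoc, Matrix.nonsing_inv_mul A hAu', one_mul,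
      Matrix.mul_nonsing_inv A hAu']
  have hUU' : star U * U = 1 := mul_eq_one_comm.mp hUU
  have hiso : ∀ V : Matrix (Fin m) (Fin m) ℝ, star V * V = 1 → ∀ x, ‖Φ V x‖ = ‖x‖ := by
    intro V hV x
    have h : inner ℝ (Φ V x) (Φ V x) = inner ℝ x x := by
      rw [← ContinuousLinearMap.adjoint_inner_right, ← ContinuousLinearMap.star_eq_adjoint,
        ← map_star, ← mul_apply_eq_comp, ← map_mul, hV, map_one,
        one_apply_eq_self]
    rw [real_inner_self_eq_norm_sq, real_inner_self_eq_norm_sq] at h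
    exact (sq_eq_sq₀ (norm_nonneg _) (norm_nonneg _)).mp h
  refine ⟨A, hA, ?_, ?_⟩
  · rw [← hdet, ← abs_of_pos hA.det_pos]
    exact (sq_eq_sq_iff_abs_eq_abs _ _).mp (by rw [sq, sq, hdetA])
  · have hT : ∀ x, T x = Φ A (Φ U x) := by
      intro x
      rw [← mul_apply_eq_comp, ← map_mul, hAUM, hM]
      rfl
    ext z
    constructor
    · rintro ⟨x, hx, rfl⟩
      refine ⟨Φ U x, ?_, (hT x).symm⟩
      rw [mem_closedBall_zero_iff] at hx ⊢
      rwa [hiso U hUU']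
    · rintro ⟨x, hx, rfl⟩
      refine ⟨Φ (star U) x, ?_, ?_⟩
      · rw [mem_closedBall_zero_iff] at hx ⊢
        rwa [hiso (star U) (by rw [star_star, hUU])]
      · rw [hT, ← mul_apply_eq_comp (Φ U), ← map_mul, hUU, map_one,
          one_apply_eq_self]

/-- The inequality of arithmetic and geometric means for the eigenvalues of a positive definite
matrix, with its equality case. -/
theorem Matrix.PosDef.det_le_one_of_trace_le {ι : Type*} [Fintype ι] [DecidableEq ι]
    {A : Matrix ι ι ℝ} (hA : A.PosDef) (h : A.trace ≤ Fintype.card ι) :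
    A.det ≤ 1 ∧ (1 ≤ A.det → A = 1) := by
  have hpos := hA.eigenvalues_pos
  have htr : A.trace = ∑ i, hA.isHermitian.eigenvalues i := by
    simpa using hA.isHermitian.trace_eq_sum_eigenvalues
  have hdet : A.det = ∏ i, hA.isHermitian.eigenvalues i := by
    simpa using hA.isHermitian.det_eq_prod_eigenvalues
  have hlog : Real.log A.det = ∑ i, Real.log (hA.isHermitian.eigenvalues i) := by
    rw [hdet, Real.log_prod fun i _ => (hpos i).ne']
  have hsum : ∑ i, (hA.isHermitian.eigenvalues i - 1) ≤ 0 := by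
    rw [Finset.sum_sub_distrib, ← htr]
    simpa using h
  -- Summing `log t ≤ t - 1` over the eigenvalues gives `log det A ≤ tr A - card ι ≤ 0`. This
  -- inequality is strict unless `t = 1`, which settles the equality case.
  have hle : ∀ i ∈ Finset.univ, Real.log (hA.isHermitian.eigenvalues i) ≤
      hA.isHermitian.eigenvalues i - 1 := fun i _ => Real.log_le_sub_one_of_pos (hpos i)
  refine ⟨?_, fun h1 => ?_⟩
  · rw [← Real.log_nonpos_iff hA.det_pos.le, hlog]
    exact (Finset.sum_le_sum hle).trans hsum
  · have h0 := Real.log_nonneg h1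
    rw [hlog] at h0
    have heq := (Finset.sum_eq_sum_iff_of_le hle).mp
      (le_antisymm (Finset.sum_le_sum hle) (hsum.trans h0))
    have hone : hA.isHermitian.eigenvalues = fun _ => 1 := by
      funext i
      by_contra hi
      exact (Real.log_lt_sub_one_of_pos (hpos i) hi).ne (heq i (Finset.mem_univ i))
    rw [hA.isHermitian.spectral_theorem, hone]
    have : Matrix.diagonal ((RCLike.ofReal : ℝ → ℝ) ∘ fun _ : ι => (1 : ℝ)) = 1 := by
      ext i j
      simp [Matrix.diagonal, Matrix.one_apply]
    rw [this, map_one]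

/-! ### John decompositions and the determinant bounds they imply. -/

/-- Weighted vectors forming a decomposition of the identity, with vanishing first moment. -/
structure IsJohnDecomposition {m : ℕ} {ι : Type*} [Fintype ι]
    (w : ι → ℝ) (u : ι → EuclideanSpace ℝ (Fin m)) : Prop where
  pos : ∀ i, 0 < w i
  norm_eq : ∀ i, ‖u i‖ = 1
  sum_smul : ∑ i, w i • u i = 0
  sum_inner : ∀ x y, ∑ i, w i * (inner ℝ (u i) x * inner ℝ (u i) y) = inner ℝ x y

namespace IsJohnDecomposition

variable {m : ℕ} {ι : Type*} [Fintype ι] {w : ι → ℝ} {u : ι → EuclideanSpace ℝ (Fin m)}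

theorem sum_inner_left (h : IsJohnDecomposition w u) (x : EuclideanSpace ℝ (Fin m)) :
    ∑ i, w i * inner ℝ (u i) x = 0 := by
  have := congrArg (fun z => inner ℝ z x) h.sum_smul
  simpa only [_root_.sum_inner, real_inner_smul_left, inner_zero_left] using this

/-- This is `∑ w u ⊗ u = I` paired with `A`. It converts pointwise bounds at the `u i` into a bound
on the trace; `A = 1` gives the total weight. -/
theorem sum_inner_apply (h : IsJohnDecomposition w u) (A : Matrix (Fin m) (Fin m) ℝ) :
    ∑ i, w i * inner ℝ (u i) (Matrix.toEuclideanCLM (n := Fin m) (𝕜 := ℝ) A (u i)) =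
      A.trace := by
  have hab : ∀ a b, ∑ i, w i * (u i a * u i b) = if a = b then 1 else 0 := by
    intro a b
    have := h.sum_inner (EuclideanSpace.single a 1) (EuclideanSpace.single b 1)
    simpa [EuclideanSpace.inner_single_right, PiLp.single_apply, eq_comm] using this
  have hin : ∀ i, w i * inner ℝ (u i) (Matrix.toEuclideanCLM (n := Fin m) (𝕜 := ℝ) A (u i)) =
      ∑ a, ∑ b, A a b * (w i * (u i a * u i b)) := by
    intro i
    rw [Matrix.inner_toEuclideanCLM]
    simp only [dotProduct, Matrix.mulVec, Finset.mul_sum]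
    refine Finset.sum_congr rfl fun a _ => Finset.sum_congr rfl fun b _ => ?_
    ring
  simp only [hin]
  rw [Finset.sum_comm]
  simp only [Matrix.trace, Matrix.diag]
  refine Finset.sum_congr rfl fun a _ => ?_
  rw [Finset.sum_comm]
  simp only [← Finset.mul_sum, hab]
  simp

theorem sum_weights (h : IsJohnDecomposition w u) : ∑ i, w i = m := by
  have := h.sum_inner_apply 1
  simpa [h.norm_eq] using this

/-- With `T` replaced by its positive definite factor `A`, the test point `p + A (u i)` gives `⟪u i,
p⟫ + ⟪u i, A (u i)⟫ ≤ 1`. In the weighted sum the terms in `p` cancel, leaving `tr A ≤ m`. If `A =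
1`, every `⟪u i, p⟫` is nonpositive with weighted sum zero, so all vanish and `‖p‖² = 0`. -/
theorem det_le_one_of_forall_inner_le (h : IsJohnDecomposition w u)
    (p : EuclideanSpace ℝ (Fin m))
    (T : EuclideanSpace ℝ (Fin m) ≃L[ℝ] EuclideanSpace ℝ (Fin m))
    (hT : ∀ y, ‖y‖ ≤ 1 → ∀ i, inner ℝ (u i) (p + T y) ≤ 1) :
    |LinearMap.det (T : EuclideanSpace ℝ (Fin m) →ₗ[ℝ] EuclideanSpace ℝ (Fin m))| ≤ 1 ∧
      (1 ≤ |LinearMap.det (T : EuclideanSpace ℝ (Fin m) →ₗ[ℝ] EuclideanSpace ℝ (Fin m))| →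
        p = 0 ∧ T '' Metric.closedBall 0 1 = Metric.closedBall 0 1) := by
  obtain ⟨A, hA, hdet, him⟩ := exists_posDef_image_closedBall_eq T
  have hT' : ∀ i, inner ℝ (u i) p +
      inner ℝ (u i) (Matrix.toEuclideanCLM (n := Fin m) (𝕜 := ℝ) A (u i)) ≤ 1 := by
    intro i
    have hmem : Matrix.toEuclideanCLM (n := Fin m) (𝕜 := ℝ) A (u i) ∈
        T '' Metric.closedBall 0 1 := by
      rw [him]
      exact ⟨u i, by simp [h.norm_eq], rfl⟩
    obtain ⟨y, hy, hyT⟩ := hmem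
    rw [← inner_add_right, ← hyT]
    exact hT y (by simpa using hy) i
  have htr : A.trace ≤ Fintype.card (Fin m) := by
    rw [Fintype.card_fin, ← h.sum_weights, ← h.sum_inner_apply]
    have := Finset.sum_le_sum fun i (_ : i ∈ Finset.univ) =>
      mul_le_mul_of_nonneg_left (hT' i) (h.pos i).le
    simpa [mul_add, Finset.sum_add_distrib, h.sum_inner_left] using this
  obtain ⟨h1, h2⟩ := hA.det_le_one_of_trace_le htr
  rw [← hdet]
  refine ⟨h1, fun hge => ?_⟩
  have hA1 := h2 hge
  subst hA1
  refine ⟨?_, by rw [him]; simp⟩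
  have hle : ∀ i ∈ Finset.univ, w i * inner ℝ (u i) p ≤ 0 := by
    intro i _
    have := hT' i
    rw [map_one, one_apply_eq_self, real_inner_self_eq_norm_sq, h.norm_eq] at this
    exact mul_nonpos_of_nonneg_of_nonpos (h.pos i).le (by linarith)
  have hz := (Finset.sum_eq_zero_iff_of_nonpos hle).mp (h.sum_inner_left p)
  have := h.sum_inner p p
  rw [← inner_self_eq_zero (𝕜 := ℝ), ← this]
  refine Finset.sum_eq_zero fun i hi => ?_
  rw [← mul_assoc, hz i hi, zero_mul]

/-- Dual argument: `‖A⁻¹ (u i - p)‖ ≤ 1` and Cauchy-Schwarz against `u i` bound `tr A⁻¹` by `m`. -/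
theorem one_le_det_of_forall_mem (h : IsJohnDecomposition w u)
    (p : EuclideanSpace ℝ (Fin m))
    (T : EuclideanSpace ℝ (Fin m) ≃L[ℝ] EuclideanSpace ℝ (Fin m))
    (hT : ∀ i, ∃ y, ‖y‖ ≤ 1 ∧ u i = p + T y) :
    1 ≤ |LinearMap.det (T : EuclideanSpace ℝ (Fin m) →ₗ[ℝ] EuclideanSpace ℝ (Fin m))| ∧
      (|LinearMap.det (T : EuclideanSpace ℝ (Fin m) →ₗ[ℝ] EuclideanSpace ℝ (Fin m))| ≤ 1 →
        p = 0 ∧ T '' Metric.closedBall 0 1 = Metric.closedBall 0 1) := by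
  obtain ⟨A, hA, hdet, him⟩ := exists_posDef_image_closedBall_eq T
  have hAu : IsUnit A.det := isUnit_iff_ne_zero.mpr hA.det_pos.ne'
  have hT' : ∀ i, ‖Matrix.toEuclideanCLM (n := Fin m) (𝕜 := ℝ) A⁻¹ (u i - p)‖ ≤ 1 := by
    intro i
    obtain ⟨y, hy, hyT⟩ := hT i
    have hmem : T y ∈ T '' Metric.closedBall 0 1 := ⟨y, by simpa using hy, rfl⟩
    rw [him] at hmem
    obtain ⟨z, hz, hzT⟩ := hmem
    rw [hyT, add_sub_cancel_left, ← hzT, ← mul_apply_eq_comp, ← map_mul,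
      Matrix.nonsing_inv_mul A hAu, map_one, one_apply_eq_self]
    simpa using hz
  have hle : ∀ i, inner ℝ (u i) (Matrix.toEuclideanCLM (n := Fin m) (𝕜 := ℝ) A⁻¹ (u i)) -
      inner ℝ (u i) (Matrix.toEuclideanCLM (n := Fin m) (𝕜 := ℝ) A⁻¹ p) ≤ 1 := by
    intro i
    rw [← inner_sub_right, ← map_sub]
    refine (real_inner_le_norm _ _).trans ?_
    rw [h.norm_eq, one_mul]
    exact hT' i
  have htr : A⁻¹.trace ≤ Fintype.card (Fin m) := by
    rw [Fintype.card_fin, ← h.sum_weights, ← h.sum_inner_apply]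
    have := Finset.sum_le_sum fun i (_ : i ∈ Finset.univ) =>
      mul_le_mul_of_nonneg_left (hle i) (h.pos i).le
    simpa [mul_sub, Finset.sum_sub_distrib, h.sum_inner_left] using this
  obtain ⟨h1, h2⟩ := hA.inv.det_le_one_of_trace_le htr
  have hinv : A⁻¹.det * A.det = 1 := by
    rw [← Matrix.det_mul, Matrix.nonsing_inv_mul A hAu, Matrix.det_one]
  have hpos := hA.det_pos
  rw [← hdet]
  refine ⟨by nlinarith, fun hge => ?_⟩
  have hI1 := h2 (by nlinarith [hA.inv.det_pos])
  have hA1 : A = 1 := by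
    rw [← Matrix.nonsing_inv_nonsing_inv A hAu, hI1, inv_one]
  subst hA1
  refine ⟨?_, by rw [him]; simp⟩
  -- When `A = 1` this is `‖u i - p‖ ≤ 1` expanded; its weighted sum reads `m ‖p‖² ≤ 0`.
  have hle : ∀ i, ‖p‖ ^ 2 ≤ 2 * inner ℝ (u i) p := by
    intro i
    have := hT' i
    rw [inv_one, map_one, one_apply_eq_self] at this
    have h3 := norm_sub_sq_real (u i) p
    rw [h.norm_eq] at h3
    nlinarith [norm_nonneg (u i - p)]
  have hsum : ∀ i ∈ Finset.univ, w i * ‖p‖ ^ 2 ≤ 2 * (w i * inner ℝ (u i) p) := by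
    intro i _
    nlinarith [hle i, h.pos i]
  have := Finset.sum_le_sum hsum
  rw [← Finset.mul_sum, h.sum_inner_left, ← Finset.sum_mul, h.sum_weights, mul_zero] at this
  rcases Nat.eq_zero_or_pos m with rfl | hm
  · exact Subsingleton.elim _ _
  · have hm' : (0 : ℝ) < m := by exact_mod_cast hm
    have h4 : ‖p‖ ^ 2 ≤ 0 := by
      by_contra hc
      push Not at hc
      nlinarith [mul_pos hm' hc]
    simpa using le_antisymm h4 (sq_nonneg _)

end IsJohnDecomposition

/-! ### Volumes of ellipsoids and normalisation of the candidate to the unit ball. -/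

theorem volume_ellipsoid {m : ℕ} (p : EuclideanSpace ℝ (Fin m))
    (T : EuclideanSpace ℝ (Fin m) ≃L[ℝ] EuclideanSpace ℝ (Fin m)) :
    volume ((fun x => p + T x) '' Metric.closedBall 0 1) =
      ENNReal.ofReal
        |LinearMap.det (T : EuclideanSpace ℝ (Fin m) →ₗ[ℝ] EuclideanSpace ℝ (Fin m))| *
        volume (Metric.closedBall (0 : EuclideanSpace ℝ (Fin m)) 1) := by
  have : (fun x => p + T x) '' Metric.closedBall 0 1 =
      (fun x => p + x) '' (T '' Metric.closedBall 0 1) := by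
    rw [Set.image_image]
  rw [this, Set.image_add_left, measure_preimage_add, Measure.addHaar_image_continuousLinearEquiv]

theorem volume_ellipsoid_le_iff {m : ℕ} (p q : EuclideanSpace ℝ (Fin m))
    (T D : EuclideanSpace ℝ (Fin m) ≃L[ℝ] EuclideanSpace ℝ (Fin m)) :
    volume ((fun x => p + T x) '' Metric.closedBall 0 1) ≤
        volume ((fun x => q + D x) '' Metric.closedBall 0 1) ↔
      |LinearMap.det (T : EuclideanSpace ℝ (Fin m) →ₗ[ℝ] EuclideanSpace ℝ (Fin m))| ≤
        |LinearMap.det (D : EuclideanSpace ℝ (Fin m) →ₗ[ℝ] EuclideanSpace ℝ (Fin m))| := by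
  rw [volume_ellipsoid, volume_ellipsoid, ENNReal.mul_le_mul_iff_left
    (Metric.measure_closedBall_pos volume _ one_pos).ne' measure_closedBall_lt_top.ne,
    ENNReal.ofReal_le_ofReal_iff (abs_nonneg _)]

/-- In coordinates where the candidate `c + D B` is the unit ball, a competitor has linear part `D⁻¹
T`, so comparing volumes means comparing `|det (D⁻¹ T)|` with `1`. -/
theorem abs_det_trans_symm {m : ℕ}
    (T D : EuclideanSpace ℝ (Fin m) ≃L[ℝ] EuclideanSpace ℝ (Fin m)) :
    |LinearMap.det (T : EuclideanSpace ℝ (Fin m) →ₗ[ℝ] EuclideanSpace ℝ (Fin m))| =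
      |LinearMap.det (D : EuclideanSpace ℝ (Fin m) →ₗ[ℝ] EuclideanSpace ℝ (Fin m))| *
      |LinearMap.det
        ((T.trans D.symm : EuclideanSpace ℝ (Fin m) ≃L[ℝ] EuclideanSpace ℝ (Fin m)) :
          EuclideanSpace ℝ (Fin m) →ₗ[ℝ] EuclideanSpace ℝ (Fin m))| := by
  rw [← abs_mul, ← LinearMap.det_comp]
  congr 2
  ext1 x
  simp

theorem abs_det_pos {m : ℕ} (D : EuclideanSpace ℝ (Fin m) ≃L[ℝ] EuclideanSpace ℝ (Fin m)) :
    0 < |LinearMap.det (D : EuclideanSpace ℝ (Fin m) →ₗ[ℝ] EuclideanSpace ℝ (Fin m))| :=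
  abs_pos.mpr (LinearEquiv.isUnit_det' D.toLinearEquiv).ne_zero

theorem ellipsoid_eq_of_normalized {m : ℕ} (p c : EuclideanSpace ℝ (Fin m))
    (T D : EuclideanSpace ℝ (Fin m) ≃L[ℝ] EuclideanSpace ℝ (Fin m))
    (h : D.symm (p - c) = 0 ∧ T.trans D.symm '' Metric.closedBall 0 1 = Metric.closedBall 0 1) :
    p = c ∧ (fun x => p + T x) '' Metric.closedBall 0 1 =
      (fun x => c + D x) '' Metric.closedBall 0 1 := by
  have hp : p = c := by
    have := h.1
    rwa [map_eq_zero_iff _ D.symm.injective, sub_eq_zero] at this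
  refine ⟨hp, ?_⟩
  conv_rhs => rw [← h.2, Set.image_image]
  simp [hp]

/-! ### John's contact criterion for general bodies. -/

section Contact

variable {m : ℕ} {ι : Type*} [Fintype ι] {w : ι → ℝ} {u : ι → EuclideanSpace ℝ (Fin m)}
  {K : Set (EuclideanSpace ℝ (Fin m))} {c : EuclideanSpace ℝ (Fin m)}
  {D : EuclideanSpace ℝ (Fin m) ≃L[ℝ] EuclideanSpace ℝ (Fin m)}

/-- John's contact criterion for the ellipsoid of maximal volume. -/
theorem john_of_contact (h : IsJohnDecomposition w u) (hin : ∀ y, ‖y‖ ≤ 1 → c + D y ∈ K)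
    (hout : ∀ y, c + D y ∈ K → ∀ i, inner ℝ (u i) y ≤ 1) :
    (∃! J, IsJohnEllipsoid K J) ∧ ∀ p, IsJohnCenter K p ↔ p = c := by
  have key : ∀ p (T : EuclideanSpace ℝ (Fin m) ≃L[ℝ] EuclideanSpace ℝ (Fin m)),
      (fun x => p + T x) '' Metric.closedBall 0 1 ⊆ K → _ := fun p T hK =>
    h.det_le_one_of_forall_inner_le (D.symm (p - c)) (T.trans D.symm) (by
      intro y hy
      refine hout _ ?_
      have : c + D (D.symm (p - c) + (T.trans D.symm) y) = p + T y := by simp [← add_assoc]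
      rw [this]
      exact hK ⟨y, by simpa using hy, rfl⟩)
  have hsub : (fun x => c + D x) '' Metric.closedBall 0 1 ⊆ K := by
    rintro _ ⟨y, hy, rfl⟩
    exact hin y (by simpa using hy)
  have hJ : IsJohnEllipsoid K ((fun x => c + D x) '' Metric.closedBall 0 1) := by
    refine ⟨⟨c, D, rfl⟩, hsub, ?_⟩
    rintro E ⟨p, T, rfl⟩ hE
    rw [volume_ellipsoid_le_iff, abs_det_trans_symm T D]
    exact mul_le_of_le_one_right (abs_det_pos D).le (key p T hE).1
  have huniq : ∀ p (T : EuclideanSpace ℝ (Fin m) ≃L[ℝ] EuclideanSpace ℝ (Fin m)),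
      IsJohnEllipsoid K ((fun x => p + T x) '' Metric.closedBall 0 1) →
      p = c ∧ (fun x => p + T x) '' Metric.closedBall 0 1 =
        (fun x => c + D x) '' Metric.closedBall 0 1 := by
    intro p T hT
    have hv := hT.2.2 _ hJ.1 hsub
    rw [volume_ellipsoid_le_iff, abs_det_trans_symm T D] at hv
    exact ellipsoid_eq_of_normalized p c T D
      ((key p T hT.2.1).2 (le_of_mul_le_mul_left (by rwa [mul_one]) (abs_det_pos D)))
  refine ⟨⟨_, hJ, ?_⟩, fun p => ⟨?_, ?_⟩⟩
  · intro J hJ'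
    obtain ⟨p, T, rfl⟩ := hJ'.1
    exact (huniq p T hJ').2
  · rintro ⟨J, hJ', T, rfl⟩
    exact (huniq p T hJ').1
  · rintro rfl
    exact ⟨_, hJ, D, rfl⟩

/-- John's contact criterion for the ellipsoid of minimal volume. -/
theorem lowner_of_contact (h : IsJohnDecomposition w u) (hin : ∀ i, c + D (u i) ∈ K)
    (hout : K ⊆ (fun x => c + D x) '' Metric.closedBall 0 1) :
    (∃! L, IsLownerEllipsoid K L) ∧ ∀ p, IsLownerCenter K p ↔ p = c := by
  have key : ∀ p (T : EuclideanSpace ℝ (Fin m) ≃L[ℝ] EuclideanSpace ℝ (Fin m)),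
      K ⊆ (fun x => p + T x) '' Metric.closedBall 0 1 → _ := fun p T hK =>
    h.one_le_det_of_forall_mem (D.symm (p - c)) (T.trans D.symm) (by
      intro i
      obtain ⟨y, hy, hyT⟩ := hK (hin i)
      refine ⟨y, by simpa using hy, D.injective ?_⟩
      simp only [map_add, ContinuousLinearEquiv.apply_symm_apply, ContinuousLinearEquiv.trans_apply]
      rw [eq_sub_of_add_eq' hyT.symm, add_sub_right_comm])
  have hL : IsLownerEllipsoid K ((fun x => c + D x) '' Metric.closedBall 0 1) := by
    refine ⟨⟨c, D, rfl⟩, hout, ?_⟩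
    rintro E ⟨p, T, rfl⟩ hE
    rw [volume_ellipsoid_le_iff, abs_det_trans_symm T D]
    exact le_mul_of_one_le_right (abs_det_pos D).le (key p T hE).1
  have huniq : ∀ p (T : EuclideanSpace ℝ (Fin m) ≃L[ℝ] EuclideanSpace ℝ (Fin m)),
      IsLownerEllipsoid K ((fun x => p + T x) '' Metric.closedBall 0 1) →
      p = c ∧ (fun x => p + T x) '' Metric.closedBall 0 1 =
        (fun x => c + D x) '' Metric.closedBall 0 1 := by
    intro p T hT
    have hv := hT.2.2 _ hL.1 hout
    rw [volume_ellipsoid_le_iff, abs_det_trans_symm T D] at hv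
    exact ellipsoid_eq_of_normalized p c T D
      ((key p T hT.2.1).2 (le_of_mul_le_mul_left (by rwa [mul_one]) (abs_det_pos D)))
  refine ⟨⟨_, hL, ?_⟩, fun p => ⟨?_, ?_⟩⟩
  · intro L hL'
    obtain ⟨p, T, rfl⟩ := hL'.1
    exact (huniq p T hL').2
  · rintro ⟨L, hL', T, rfl⟩
    exact (huniq p T hL').1
  · rintro rfl
    exact ⟨_, hL, D, rfl⟩

end Contact

/-! ### Coordinates on `ℝⁿ × ℝ` and axis-parallel scalings. -/

section AtHeight

variable {n : ℕ}

theorem inner_atHeight (s t : ℝ) (x y : EuclideanSpace ℝ (Fin n)) :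
    inner ℝ (atHeight s x) (atHeight t y) = s * t + inner ℝ x y := by
  simp only [atHeight, PiLp.inner_apply, Fin.sum_univ_castSucc, Fin.snoc_castSucc, Fin.snoc_last]
  simp [mul_comm, add_comm]

theorem norm_sq_atHeight (t : ℝ) (x : EuclideanSpace ℝ (Fin n)) :
    ‖atHeight t x‖ ^ 2 = t ^ 2 + ‖x‖ ^ 2 := by
  rw [← real_inner_self_eq_norm_sq, inner_atHeight, real_inner_self_eq_norm_sq, sq t]

theorem atHeight_add (s t : ℝ) (x y : EuclideanSpace ℝ (Fin n)) :
    atHeight s x + atHeight t y = atHeight (s + t) (x + y) := by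
  ext i
  refine Fin.lastCases ?_ (fun j => ?_) i <;> simp [atHeight]

theorem smul_atHeight (r t : ℝ) (x : EuclideanSpace ℝ (Fin n)) :
    r • atHeight t x = atHeight (r * t) (r • x) := by
  ext i
  refine Fin.lastCases ?_ (fun j => ?_) i <;> simp [atHeight]

theorem atHeight_zero : atHeight 0 (0 : EuclideanSpace ℝ (Fin n)) = 0 := by
  ext i
  refine Fin.lastCases ?_ (fun j => ?_) i <;> simp [atHeight]

theorem sum_atHeight {ι : Type*} (s : Finset ι) (t : ι → ℝ) (x : ι → EuclideanSpace ℝ (Fin n)) :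
    ∑ i ∈ s, atHeight (t i) (x i) = atHeight (∑ i ∈ s, t i) (∑ i ∈ s, x i) := by
  classical
  induction s using Finset.induction_on with
  | empty => simp [atHeight_zero]
  | insert a s ha ih => rw [Finset.sum_insert ha, Finset.sum_insert ha, Finset.sum_insert ha, ih,
      atHeight_add]

theorem single_last_eq_atHeight :
    EuclideanSpace.single (Fin.last n) (1 : ℝ) = atHeight 1 0 := by
  ext i
  refine Fin.lastCases ?_ (fun j => ?_) i <;> simp [atHeight, (Fin.castSucc_lt_last _).ne]

theorem atHeight_last_castSucc (z : EuclideanSpace ℝ (Fin (n + 1))) :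
    atHeight (z (Fin.last n)) (WithLp.toLp 2 fun i : Fin n => z i.castSucc) = z := by
  ext i
  refine Fin.lastCases ?_ (fun j => ?_) i <;> simp [atHeight]

theorem exists_eq_atHeight (z : EuclideanSpace ℝ (Fin (n + 1))) :
    ∃ (t : ℝ) (x : EuclideanSpace ℝ (Fin n)), z = atHeight t x :=
  ⟨_, _, (atHeight_last_castSucc z).symm⟩

/-- The linear map `(x, t) ↦ (a x, b t)`. -/
noncomputable def scaleMap (n : ℕ) (a b : ℝ) :
    EuclideanSpace ℝ (Fin (n + 1)) →ₗ[ℝ] EuclideanSpace ℝ (Fin (n + 1)) where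
  toFun z := atHeight (b * z (Fin.last n)) (a • WithLp.toLp 2 fun i : Fin n => z i.castSucc)
  map_add' y z := by
    ext i
    refine Fin.lastCases ?_ (fun j => ?_) i <;> simp [atHeight, mul_add]
  map_smul' r z := by
    ext i
    refine Fin.lastCases ?_ (fun j => ?_) i <;> simp [atHeight, mul_left_comm]

theorem scaleMap_atHeight (a b t : ℝ) (x : EuclideanSpace ℝ (Fin n)) :
    scaleMap n a b (atHeight t x) = atHeight (b * t) (a • x) := by
  simp [scaleMap, atHeight]

theorem scaleMap_scaleMap {a b a' b' : ℝ} (ha : a * a' = 1) (hb : b * b' = 1)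
    (z : EuclideanSpace ℝ (Fin (n + 1))) : scaleMap n a b (scaleMap n a' b' z) = z := by
  obtain ⟨t, x, rfl⟩ := exists_eq_atHeight z
  rw [scaleMap_atHeight, scaleMap_atHeight, ← mul_assoc, smul_smul, ha, hb, one_mul, one_smul]

/-- The invertible linear map `(x, t) ↦ (a x, b t)`. -/
noncomputable def scaleEquiv (n : ℕ) {a b : ℝ} (ha : a ≠ 0) (hb : b ≠ 0) :
    EuclideanSpace ℝ (Fin (n + 1)) ≃L[ℝ] EuclideanSpace ℝ (Fin (n + 1)) :=
  LinearEquiv.toContinuousLinearEquiv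
    { scaleMap n a b with
      invFun := scaleMap n a⁻¹ b⁻¹
      left_inv := scaleMap_scaleMap (inv_mul_cancel₀ ha) (inv_mul_cancel₀ hb)
      right_inv := scaleMap_scaleMap (mul_inv_cancel₀ ha) (mul_inv_cancel₀ hb) }

theorem scaleEquiv_atHeight {a b : ℝ} (ha : a ≠ 0) (hb : b ≠ 0) (t : ℝ)
    (x : EuclideanSpace ℝ (Fin n)) :
    scaleEquiv n ha hb (atHeight t x) = atHeight (b * t) (a • x) :=
  scaleMap_atHeight a b t x

end AtHeight

/-! ### Metric identities for the inscribed regular simplex. -/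

namespace IsInscribedRegularSimplex

variable {n : ℕ} {S : Affine.Simplex ℝ (EuclideanSpace ℝ (Fin n)) n}

theorem exists_inner_eq (hS : IsInscribedRegularSimplex S) (hn : 1 ≤ n) :
    ∃ c : ℝ, c ≠ 1 ∧ ∀ i j, i ≠ j → inner ℝ (S.points i) (S.points j) = c := by
  obtain ⟨⟨r, hr⟩, h1⟩ := hS
  refine ⟨1 - r ^ 2 / 2, ?_, ?_⟩
  · intro h
    have h01 : (0 : Fin (n + 1)) ≠ Fin.last n := by
      intro h
      have := congrArg Fin.val h
      simp at this
      omega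
    have hd := hr _ _ h01
    have hr0 : r = 0 := by
      have : r ^ 2 = 0 := by linarith
      simpa using this
    rw [hr0, dist_eq_zero] at hd
    exact h01 (S.independent.injective hd)
  · intro i j hij
    have := norm_sub_sq_real (S.points i) (S.points j)
    rw [← dist_eq_norm, hr i j hij, h1, h1] at this
    linarith

/-- The `n + 1` vertices are linearly dependent in dimension `n`. Pairing a relation `∑ a i • v i =
0` with `v j` gives `a j (1 - c) + c ∑ a = 0`, where `c ≠ 1` is the common inner product, so all
coefficients coincide. -/
theorem sum_points (hS : IsInscribedRegularSimplex S) (hn : 1 ≤ n) : ∑ i, S.points i = 0 := by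
  obtain ⟨c, hc, hij⟩ := hS.exists_inner_eq hn
  have hdep : ¬ LinearIndependent ℝ S.points := by
    intro h
    have := h.fintype_card_le_finrank
    simp at this
  obtain ⟨a, ha, i₀, hi₀⟩ := Fintype.not_linearIndependent_iff.mp hdep
  have hj : ∀ j, a j * (1 - c) + c * ∑ i, a i = 0 := by
    intro j
    have h := congrArg (fun z => inner ℝ z (S.points j)) ha
    simp only [sum_inner, real_inner_smul_left, inner_zero_left] at h
    rw [← h, Finset.mul_sum, ← Finset.add_sum_erase _ _ (Finset.mem_univ j),
      ← Finset.add_sum_erase (a := j) Finset.univ (fun i => a i * inner ℝ _ _) (Finset.mem_univ j),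
      real_inner_self_eq_norm_sq, hS.2]
    have hcongr : ∑ i ∈ Finset.univ.erase j, a i * inner ℝ (S.points i) (S.points j) =
        ∑ i ∈ Finset.univ.erase j, c * a i := Finset.sum_congr rfl fun i hi => by
      rw [hij i j (Finset.ne_of_mem_erase hi), mul_comm]
    rw [hcongr, ← Finset.mul_sum]
    ring
  have hc' : 1 - c ≠ 0 := sub_ne_zero.mpr hc.symm
  have hall : ∀ j, a j = a i₀ := by
    intro j
    apply mul_right_cancel₀ hc'
    linarith [hj j, hj i₀]
  simp only [hall, ← Finset.smul_sum] at ha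
  exact (smul_eq_zero.mp ha).resolve_left hi₀

theorem inner_points_of_ne (hS : IsInscribedRegularSimplex S) (hn : 1 ≤ n) {i j : Fin (n + 1)}
    (hne : i ≠ j) : inner ℝ (S.points i) (S.points j) = -(1 / (n : ℝ)) := by
  obtain ⟨c, -, hij⟩ := hS.exists_inner_eq hn
  have hn0 : (n : ℝ) ≠ 0 := by positivity
  have h := congrArg (fun z => inner ℝ z (S.points j)) (hS.sum_points hn)
  simp only [sum_inner, inner_zero_left] at h
  rw [← Finset.add_sum_erase _ _ (Finset.mem_univ j), real_inner_self_eq_norm_sq, hS.2,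
    Finset.sum_congr rfl (g := fun _ => c) fun i hi => hij i j (Finset.ne_of_mem_erase hi)] at h
  simp at h
  rw [hij i j hne]
  field_simp
  linarith

/-- By linearity it suffices to check vertices, which span the space; there the inner products `1`
and `-1/n` together with `∑ v = 0` give the constant `1 + 1/n`. -/
theorem sum_inner_smul_points (hS : IsInscribedRegularSimplex S) (hn : 1 ≤ n)
    (x : EuclideanSpace ℝ (Fin n)) :
    ∑ i, (inner ℝ (S.points i) x : ℝ) • S.points i = ((n + 1) / n : ℝ) • x := by
  have hn0 : (n : ℝ) ≠ 0 := by positivity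
  have hx : x ∈ Submodule.span ℝ (Set.range S.points) := by
    apply affineSpan_subset_span
    rw [S.independent.affineSpan_eq_top_iff_card_eq_finrank_add_one.mpr (by simp)]
    trivial
  induction hx using Submodule.span_induction with
  | mem x hx =>
    obtain ⟨j, rfl⟩ := hx
    have h := hS.sum_points hn
    rw [← Finset.add_sum_erase _ _ (Finset.mem_univ j)] at h ⊢
    rw [real_inner_self_eq_norm_sq, hS.2, Finset.sum_congr rfl
      (g := fun i => (-(1 / (n : ℝ))) • S.points i) fun i hi => by
        rw [hS.inner_points_of_ne hn (Finset.ne_of_mem_erase hi)], ← Finset.smul_sum,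
      eq_neg_of_add_eq_zero_right h, smul_neg, neg_smul, neg_neg, ← add_smul]
    congr 1
    field_simp
  | zero => simp
  | add x y _ _ hx hy => simp only [inner_add_right, add_smul, Finset.sum_add_distrib, hx, hy,
      smul_add]
  | smul r x _ hx => 
    rw [smul_comm, ← hx, Finset.smul_sum]
    simp only [inner_smul_right, mul_smul]

theorem sum_inner_mul_inner (hS : IsInscribedRegularSimplex S) (hn : 1 ≤ n)
    (x y : EuclideanSpace ℝ (Fin n)) :
    ∑ i, (inner ℝ (S.points i) x * inner ℝ (S.points i) y : ℝ) = (n + 1) / n * inner ℝ x y := by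
  have := congrArg (fun z => inner ℝ z y) (hS.sum_inner_smul_points hn x)
  simpa only [sum_inner, real_inner_smul_left] using this

theorem sum_inner_eq_zero (hS : IsInscribedRegularSimplex S) (hn : 1 ≤ n)
    (x : EuclideanSpace ℝ (Fin n)) : ∑ i, (inner ℝ (S.points i) x : ℝ) = 0 := by
  rw [← sum_inner, hS.sum_points hn, inner_zero_left]

theorem convexHull_subset_closedBall (hS : IsInscribedRegularSimplex S) :
    convexHull ℝ (Set.range S.points) ⊆ Metric.closedBall 0 1 := by
  refine convexHull_min ?_ (convex_closedBall 0 1)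
  rintro _ ⟨i, rfl⟩
  simp [hS.2]

theorem closedBall_subset_convexHull (hS : IsInscribedRegularSimplex S) (hn : 1 ≤ n) :
    Metric.closedBall 0 (1 / (n : ℝ)) ⊆ convexHull ℝ (Set.range S.points) := by
  have hn0 : (0 : ℝ) < n := by positivity
  intro x hx
  rw [mem_closedBall_zero_iff] at hx
  -- These are the barycentric coordinates of `x`; they are nonnegative because `⟪v i, x⟫ ≥ -‖x‖ ≥
  -- -1/n`.
  have hw : ∀ i, 0 ≤ (1 + n * inner ℝ (S.points i) x) / (n + 1 : ℝ) := by
    intro i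
    have h := (abs_le.mp (abs_real_inner_le_norm (S.points i) x)).1
    rw [hS.2, one_mul] at h
    have h2 : n * ‖x‖ ≤ 1 := by
      rw [le_div_iff₀ hn0] at hx
      linarith
    have : 0 ≤ 1 + n * inner ℝ (S.points i) x := by nlinarith
    positivity
  have hw1 : ∑ i, (1 + n * inner ℝ (S.points i) x) / (n + 1 : ℝ) = 1 := by
    rw [← Finset.sum_div, Finset.sum_add_distrib, ← Finset.mul_sum, hS.sum_inner_eq_zero hn]
    have : (n + 1 : ℝ) ≠ 0 := by positivity
    simp [this]
  have hsum : ∑ i, ((1 + n * inner ℝ (S.points i) x) / (n + 1 : ℝ)) • S.points i = x := by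
    have h : ∀ i, ((1 + n * inner ℝ (S.points i) x) / (n + 1 : ℝ)) • S.points i =
        (1 / (n + 1 : ℝ)) • S.points i +
          (n / (n + 1 : ℝ)) • ((inner ℝ (S.points i) x : ℝ) • S.points i) := by
      intro i
      rw [smul_smul, ← add_smul]
      congr 1
      field_simp
    simp only [h, Finset.sum_add_distrib, ← Finset.smul_sum]
    rw [hS.sum_points hn, hS.sum_inner_smul_points hn, smul_zero, zero_add, smul_smul]
    rw [show (n / (n + 1 : ℝ)) * ((n + 1) / n) = 1 by field_simp, one_smul]
  rw [← hsum]
  exact (convex_convexHull ℝ _).sum_mem (fun i _ => hw i) hw1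
    fun i _ => subset_convexHull ℝ _ ⟨i, rfl⟩

theorem neg_one_div_le_inner (hS : IsInscribedRegularSimplex S) (hn : 1 ≤ n) (i : Fin (n + 1))
    {x : EuclideanSpace ℝ (Fin n)} (hx : x ∈ convexHull ℝ (Set.range S.points)) :
    -(1 / (n : ℝ)) ≤ inner ℝ (S.points i) x := by
  have hconv : Convex ℝ {y : EuclideanSpace ℝ (Fin n) | -(1 / (n : ℝ)) ≤ inner ℝ (S.points i) y} :=
    convex_halfSpace_ge (innerSL ℝ (S.points i)).toLinearMap.isLinear _
  refine convexHull_min ?_ hconv hx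
  rintro _ ⟨j, rfl⟩
  change -(1 / (n : ℝ)) ≤ inner ℝ (S.points i) (S.points j)
  by_cases hij : i = j
  · rw [hij, real_inner_self_eq_norm_sq, hS.2]
    have : 0 ≤ 1 / (n : ℝ) := by positivity
    linarith
  · rw [hS.inner_points_of_ne hn hij]

end IsInscribedRegularSimplex

/-! ### Convexity bounds for the body. -/

section BodyM2

variable {n : ℕ} {S : Affine.Simplex ℝ (EuclideanSpace ℝ (Fin n)) n}

theorem bodyM2_subset_of_convex (C : Set (EuclideanSpace ℝ (Fin (n + 1)))) (hC : Convex ℝ C)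
    (h0 : ∀ x ∈ convexHull ℝ (Set.range S.points), atHeight 0 x ∈ C)
    (h1 : ∀ x, ‖x‖ ≤ 1 / (n : ℝ) → atHeight 1 x ∈ C) : bodyM2 S ⊆ C := by
  refine convexHull_min (Set.union_subset ?_ ?_) hC
  · rintro _ ⟨x, hx, rfl⟩
    exact h0 x hx
  · rintro _ ⟨x, hx, rfl⟩
    exact h1 x (by simpa using hx)

theorem atHeight_zero_mem_bodyM2 {x : EuclideanSpace ℝ (Fin n)}
    (hx : x ∈ convexHull ℝ (Set.range S.points)) : atHeight 0 x ∈ bodyM2 S :=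
  subset_convexHull ℝ _ (Or.inl ⟨x, hx, rfl⟩)

theorem atHeight_one_mem_bodyM2 {x : EuclideanSpace ℝ (Fin n)} (hx : ‖x‖ ≤ 1 / (n : ℝ)) :
    atHeight 1 x ∈ bodyM2 S :=
  subset_convexHull ℝ _ (Or.inr ⟨x, by simpa using hx, rfl⟩)

theorem bodyM2_subset_halfSpace (a : EuclideanSpace ℝ (Fin n)) (s r : ℝ)
    (h0 : ∀ x ∈ convexHull ℝ (Set.range S.points), inner ℝ a x ≤ r)
    (h1 : ∀ x, ‖x‖ ≤ 1 / (n : ℝ) → s + inner ℝ a x ≤ r)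
    {t : ℝ} {x : EuclideanSpace ℝ (Fin n)} (hx : atHeight t x ∈ bodyM2 S) :
    s * t + inner ℝ a x ≤ r := by
  have := bodyM2_subset_of_convex {z | inner ℝ (atHeight s a) z ≤ r}
    (convex_halfSpace_le (innerSL ℝ (atHeight s a)).toLinearMap.isLinear _)
    (fun x hx => by simpa [inner_atHeight] using h0 x hx)
    (fun x hx => by simpa [inner_atHeight] using h1 x hx) hx
  simpa [inner_atHeight] using this

end BodyM2

/-! ### The two contact configurations. -/

namespace IsInscribedRegularSimplex

variable {n : ℕ} {S : Affine.Simplex ℝ (EuclideanSpace ℝ (Fin n)) n}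

/-- The vectors are the outer unit normals of the prism `Δ × [0,1]`. The weight `n/(n+1)` cancels
the constant `(n+1)/n` in the horizontal directions, and the two weights `1/2` supply the vertical
one. -/
theorem isJohnDecomposition_john (hS : IsInscribedRegularSimplex S) (hn : 1 ≤ n) :
    IsJohnDecomposition (Sum.elim (fun _ : Fin (n + 1) => (n / (n + 1) : ℝ)) fun _ : Bool => 1 / 2)
      (Sum.elim (fun i => atHeight 0 (-S.points i)) fun b => atHeight (cond b 1 (-1)) 0) where
  pos i := by
    have : (0 : ℝ) < n := by positivity
    rcases i with i | b
    · simp only [Sum.elim_inl]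
      positivity
    · simp
  norm_eq i := by
    rw [← sq_eq_sq₀ (norm_nonneg _) one_pos.le]
    rcases i with i | b
    · simp [norm_sq_atHeight, hS.2]
    · cases b <;> simp [norm_sq_atHeight]
  sum_smul := by
    simp only [Fintype.sum_sum_type, Sum.elim_inl, Sum.elim_inr, Fintype.sum_bool, smul_atHeight,
      sum_atHeight, ← Finset.smul_sum, Finset.sum_neg_distrib, hS.sum_points hn, atHeight_add]
    simp [atHeight_zero]
  sum_inner x y := by
    obtain ⟨s, x, rfl⟩ := exists_eq_atHeight x
    obtain ⟨t, y, rfl⟩ := exists_eq_atHeight y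
    have hn0 : (n : ℝ) ≠ 0 := by positivity
    simp only [Fintype.sum_sum_type, Sum.elim_inl, Sum.elim_inr, Fintype.sum_bool, inner_atHeight,
      inner_neg_left, zero_mul, zero_add, neg_mul_neg, ← Finset.mul_sum, hS.sum_inner_mul_inner hn,
      inner_zero_left, cond_true, cond_false]
    field_simp
    ring

theorem john_bodyM2 (hS : IsInscribedRegularSimplex S) (hn : 1 ≤ n) :
    (∃! J, IsJohnEllipsoid (bodyM2 S) J) ∧
      ∀ p, IsJohnCenter (bodyM2 S) p ↔ p = atHeight (1 / 2) 0 := by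
  have hn0 : (0 : ℝ) < n := by positivity
  have hD : ∀ t (x : EuclideanSpace ℝ (Fin n)), atHeight (1 / 2) 0 +
      scaleEquiv n (one_div_ne_zero hn0.ne') (one_half_pos (α := ℝ)).ne' (atHeight t x) =
      atHeight ((1 + t) / 2) ((1 / n : ℝ) • x) := by
    intro t x
    rw [scaleEquiv_atHeight, atHeight_add, zero_add]
    congr 1
    ring
  refine john_of_contact (hS.isJohnDecomposition_john hn)
    (D := scaleEquiv n (one_div_ne_zero hn0.ne') (one_half_pos (α := ℝ)).ne') ?_ ?_
  · intro y hy
    obtain ⟨t, x, rfl⟩ := exists_eq_atHeight y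
    have hy2 := (sq_le_one_iff₀ (norm_nonneg _)).mpr hy
    rw [norm_sq_atHeight] at hy2
    obtain ⟨ht1, ht2⟩ := abs_le.mp ((sq_le_one_iff_abs_le_one t).mp (by nlinarith [sq_nonneg ‖x‖]))
    have hx : ‖(1 / n : ℝ) • x‖ ≤ 1 / (n : ℝ) := by
      have : ‖x‖ ≤ 1 := (sq_le_one_iff₀ (norm_nonneg _)).mp (by nlinarith [sq_nonneg t])
      rw [norm_smul, Real.norm_of_nonneg (by positivity)]
      exact mul_le_of_le_one_right (by positivity) this
    -- The point lies on a vertical segment joining the bottom face to the top face, over a point of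
    -- the inball.
    rw [hD, show atHeight ((1 + t) / 2) ((1 / n : ℝ) • x) =
        ((1 - t) / 2) • atHeight 0 ((1 / n : ℝ) • x) +
        ((1 + t) / 2) • atHeight 1 ((1 / n : ℝ) • x) by
      rw [smul_atHeight, smul_atHeight, atHeight_add, ← add_smul]
      congr 1
      · ring
      · rw [show (1 - t) / 2 + (1 + t) / 2 = 1 by ring, one_smul]]
    exact convex_convexHull ℝ _
      (atHeight_zero_mem_bodyM2 (hS.closedBall_subset_convexHull hn (by simpa using hx)))
      (atHeight_one_mem_bodyM2 hx) (by linarith) (by linarith) (by ring)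
  · intro y hy i
    obtain ⟨t, x, rfl⟩ := exists_eq_atHeight y
    rw [hD] at hy
    have hball : ∀ x : EuclideanSpace ℝ (Fin n), ‖x‖ ≤ 1 / (n : ℝ) →
        x ∈ convexHull ℝ (Set.range S.points) := fun x hx =>
      hS.closedBall_subset_convexHull hn (by simpa using hx)
    have hpts : ∀ i, ∀ x ∈ convexHull ℝ (Set.range S.points),
        inner ℝ (-S.points i) x ≤ 1 / (n : ℝ) := by
      intro i x hx
      rw [inner_neg_left]
      linarith [hS.neg_one_div_le_inner hn i hx]
    rcases i with i | b
    · have := bodyM2_subset_halfSpace (-S.points i) 0 (1 / n) (hpts i)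
        (fun x hx => by simpa using hpts i x (hball x hx)) hy
      rw [zero_mul, zero_add, inner_smul_right, mul_le_iff_le_one_right (by positivity)] at this
      rwa [Sum.elim_inl, inner_atHeight, zero_mul, zero_add]
    · rw [Sum.elim_inr, inner_atHeight, inner_zero_left, add_zero]
      cases b
      · have := bodyM2_subset_halfSpace 0 (-1) 0 (by simp) (by simp) hy
        rw [inner_zero_left] at this
        simp only [cond_false]
        linarith
      · have := bodyM2_subset_halfSpace 0 1 1 (by simp) (by simp) hy
        rw [inner_zero_left] at this
        simp only [cond_true]
        linarith

/-- The vectors are the contact points `(v i, 0)` and `(v i / n, 1)` in ball coordinates. Balancing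
the heights `-l/b` and `(1-l)/b` suggests the weights `1-l` and `l`; `hb2` and `ha2` are then the
vertical and horizontal second-moment conditions, and `h0`, `h1` say that the vectors have unit
length. -/
theorem isJohnDecomposition_lowner (hS : IsInscribedRegularSimplex S) (hn : 1 ≤ n) {a b l : ℝ}
    (ha : 0 < a) (hb : 0 < b) (hl0 : 0 < l) (hl1 : l < 1)
    (ha2 : n * a ^ 2 = (n + 1) * (1 - l + l / n ^ 2)) (hb2 : b ^ 2 = (n + 1) * (l * (1 - l)))
    (h0 : (l / b) ^ 2 + (1 / a) ^ 2 = 1) (h1 : ((1 - l) / b) ^ 2 + (1 / (n * a)) ^ 2 = 1) :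
    IsJohnDecomposition (Sum.elim (fun _ : Fin (n + 1) => 1 - l) fun _ : Fin (n + 1) => l)
      (Sum.elim (fun i => atHeight (-(l / b)) ((1 / a) • S.points i))
        fun i => atHeight ((1 - l) / b) ((1 / (n * a)) • S.points i)) where
  pos i := by
    rcases i with i | i
    · simpa using hl1
    · simpa using hl0
  norm_eq i := by
    rw [← sq_eq_sq₀ (norm_nonneg _) one_pos.le]
    rcases i with i | i <;> rw [one_pow]
    · rw [Sum.elim_inl, norm_sq_atHeight, norm_smul, hS.2, mul_one, Real.norm_eq_abs, sq_abs, neg_sq,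
        h0]
    · rw [Sum.elim_inr, norm_sq_atHeight, norm_smul, hS.2, mul_one, Real.norm_eq_abs, sq_abs, h1]
  sum_smul := by
    simp only [Fintype.sum_sum_type, Sum.elim_inl, Sum.elim_inr, smul_atHeight,
      sum_atHeight, ← Finset.smul_sum, hS.sum_points hn, atHeight_add, smul_zero, add_zero]
    rw [← atHeight_zero]
    congr 1
    simp only [Finset.sum_const, Finset.card_univ, Fintype.card_fin, nsmul_eq_mul]
    ring
  sum_inner x y := by
    obtain ⟨s, x, rfl⟩ := exists_eq_atHeight x
    obtain ⟨t, y, rfl⟩ := exists_eq_atHeight y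
    have hn0 : (n : ℝ) ≠ 0 := by positivity
    have key : ∀ h r : ℝ, ∑ i, (inner ℝ (atHeight h (r • S.points i)) (atHeight s x) *
        inner ℝ (atHeight h (r • S.points i)) (atHeight t y) : ℝ) =
        (n + 1) * (h ^ 2 * (s * t)) + r ^ 2 * ((n + 1) / n * inner ℝ x y) := by
      intro h r
      have hterm : ∀ i, (inner ℝ (atHeight h (r • S.points i)) (atHeight s x) *
          inner ℝ (atHeight h (r • S.points i)) (atHeight t y) : ℝ) =
          h ^ 2 * (s * t) + h * s * r * inner ℝ (S.points i) y +
          h * t * r * inner ℝ (S.points i) x +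
          r ^ 2 * (inner ℝ (S.points i) x * inner ℝ (S.points i) y) := by
        intro i
        rw [inner_atHeight, inner_atHeight, real_inner_smul_left, real_inner_smul_left]
        ring
      simp only [hterm, Finset.sum_add_distrib, ← Finset.mul_sum, hS.sum_inner_eq_zero hn,
        hS.sum_inner_mul_inner hn, Finset.sum_const, Finset.card_univ, Fintype.card_fin,
        nsmul_eq_mul]
      push_cast
      ring
    simp only [Fintype.sum_sum_type, Sum.elim_inl, Sum.elim_inr, ← Finset.mul_sum]
    rw [key, key, inner_atHeight]
    have e1 : (n + 1) * ((1 - l) * (l / b) ^ 2 + l * ((1 - l) / b) ^ 2) = 1 := by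
      field_simp
      rw [hb2]
      ring
    have e2 : (n + 1) / n * ((1 - l) * (1 / a) ^ 2 + l * (1 / (n * a)) ^ 2) = 1 := by
      have ha2' : n * a ^ 2 * n ^ 2 = (n + 1) * ((1 - l) * n ^ 2 + l) := by
        rw [ha2]
        field_simp
      field_simp
      linear_combination -ha2'
    linear_combination (s * t) * e1 + inner ℝ x y * e2

theorem lowner_bodyM2 (hS : IsInscribedRegularSimplex S) (hn : 1 ≤ n) {a b l : ℝ}
    (ha : 0 < a) (hb : 0 < b) (hl0 : 0 < l) (hl1 : l < 1)
    (ha2 : n * a ^ 2 = (n + 1) * (1 - l + l / n ^ 2)) (hb2 : b ^ 2 = (n + 1) * (l * (1 - l)))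
    (h0 : (l / b) ^ 2 + (1 / a) ^ 2 = 1) (h1 : ((1 - l) / b) ^ 2 + (1 / (n * a)) ^ 2 = 1) :
    (∃! L, IsLownerEllipsoid (bodyM2 S) L) ∧
      ∀ p, IsLownerCenter (bodyM2 S) p ↔ p = atHeight l 0 := by
  have hn0 : (0 : ℝ) < n := by positivity
  have hD : ∀ t (x : EuclideanSpace ℝ (Fin n)), atHeight l 0 +
      scaleEquiv n ha.ne' hb.ne' (atHeight t x) = atHeight (l + b * t) (a • x) := by
    intro t x
    rw [scaleEquiv_atHeight, atHeight_add, zero_add]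
  have hbl : l + b * -(l / b) = 0 := by field_simp; ring
  have hbl1 : l + b * ((1 - l) / b) = 1 := by field_simp; ring
  -- A horizontal slice of the ellipsoid is a ball. By `h0` and `h1` its radius is `1` at height `0`
  -- and `1/n` at height `1`, which covers both ends of the body.
  have hmem : ∀ t r (x : EuclideanSpace ℝ (Fin n)), 0 < r → ‖x‖ ≤ r →
      ((t - l) / b) ^ 2 + (r / a) ^ 2 = 1 → atHeight t x ∈
        (fun x => atHeight l 0 + scaleEquiv n ha.ne' hb.ne' x) '' Metric.closedBall 0 1 := by
    intro t r x hr hx h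
    refine ⟨atHeight ((t - l) / b) ((1 / a) • x), ?_, ?_⟩
    · rw [mem_closedBall_zero_iff, ← sq_le_one_iff₀ (norm_nonneg _), norm_sq_atHeight, norm_smul,
        Real.norm_of_nonneg (by positivity), one_div_mul_eq_div]
      refine le_trans ?_ h.le
      gcongr
    · change atHeight l 0 + scaleEquiv n ha.ne' hb.ne' _ = _
      rw [hD, smul_smul, mul_one_div_cancel ha.ne', one_smul, mul_div_cancel₀ _ hb.ne']
      congr 1
      ring
  refine lowner_of_contact (hS.isJohnDecomposition_lowner hn ha hb hl0 hl1 ha2 hb2 h0 h1)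
    (D := scaleEquiv n ha.ne' hb.ne') ?_ ?_
  · rintro (i | i)
    · rw [Sum.elim_inl, hD, hbl, smul_smul, mul_one_div_cancel ha.ne', one_smul]
      exact atHeight_zero_mem_bodyM2 (subset_convexHull ℝ _ ⟨i, rfl⟩)
    · rw [Sum.elim_inr, hD, hbl1, smul_smul]
      refine atHeight_one_mem_bodyM2 ?_
      rw [norm_smul, hS.2, mul_one, Real.norm_of_nonneg (by positivity)]
      apply le_of_eq
      field_simp
  · refine bodyM2_subset_of_convex _ ?_ ?_ ?_
    · have := ((convex_closedBall (0 : EuclideanSpace ℝ (Fin (n + 1))) 1).linear_image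
        (scaleEquiv n ha.ne' hb.ne').toLinearEquiv.toLinearMap).translate (atHeight l 0)
      rw [Set.image_image] at this
      exact this
    · intro x hx
      refine hmem 0 1 x one_pos (by simpa using hS.convexHull_subset_closedBall hx) ?_
      linear_combination h0
    · intro x hx
      refine hmem 1 (1 / n) x (by positivity) hx ?_
      rwa [div_div]

end IsInscribedRegularSimplex

/-! ### The quadratic equation for the Löwner centre and its asymptotics. -/

/-- The height of the centre of the Löwner ellipsoid of `bodyM2`, as a function of `1 / n`. -/
noncomputable def lownerHeight (x : ℝ) : ℝ :=
  x * (2 / ((1 + 3 * x - x ^ 2 - x ^ 3) + √((1 + x - x ^ 2 - x ^ 3) ^ 2 + 4 * x ^ 4)))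

/-- The root of the quadratic is in the rationalised form `2x / (β + ρ)`, where `ρ²` is the
discriminant. This form survives at `x = 1` (that is, `n = 1`), where the leading coefficient
vanishes, and is continuous at `x = 0` after division by `x`. -/
theorem lownerHeight_spec {x : ℝ} (h0 : 0 < x) (h1 : x ≤ 1) :
    0 < lownerHeight x ∧ lownerHeight x < 1 ∧
      (1 + 2 * x) * (1 - x ^ 2) * lownerHeight x ^ 2 -
        (1 + 3 * x - x ^ 2 - x ^ 3) * lownerHeight x + x = 0 := by
  have hρ0 := Real.sqrt_nonneg ((1 + x - x ^ 2 - x ^ 3) ^ 2 + 4 * x ^ 4)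
  have hρ := Real.sq_sqrt (show 0 ≤ (1 + x - x ^ 2 - x ^ 3) ^ 2 + 4 * x ^ 4 by positivity)
  have hl : lownerHeight x = x * (2 / ((1 + 3 * x - x ^ 2 - x ^ 3) +
    √((1 + x - x ^ 2 - x ^ 3) ^ 2 + 4 * x ^ 4))) := rfl
  generalize √((1 + x - x ^ 2 - x ^ 3) ^ 2 + 4 * x ^ 4) = ρ at *
  have hx2 : x ^ 2 ≤ x := by nlinarith
  have hx3 : x ^ 3 ≤ x := by nlinarith
  have hx4 : 0 < x ^ 4 := by positivity
  have hβ : 0 < 1 + 3 * x - x ^ 2 - x ^ 3 := by linarith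
  have hd : 0 < (1 + 3 * x - x ^ 2 - x ^ 3) + ρ := by linarith
  have hlt : 2 * x < (1 + 3 * x - x ^ 2 - x ^ 3) + ρ := by
    -- The strictness comes from the term `4 * x ^ 4` in `ρ²`.
    have : -(1 + x - x ^ 2 - x ^ 3) < ρ := by
      by_contra hc
      push Not at hc
      nlinarith
    linarith
  rw [hl]
  refine ⟨by positivity, ?_, ?_⟩
  · rw [mul_div_assoc', div_lt_one hd]
    linarith
  · have hld : x * (2 / ((1 + 3 * x - x ^ 2 - x ^ 3) + ρ)) * ((1 + 3 * x - x ^ 2 - x ^ 3) + ρ) =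
        2 * x := by
      rw [mul_assoc, div_mul_cancel₀ _ hd.ne', mul_comm]
    generalize x * (2 / ((1 + 3 * x - x ^ 2 - x ^ 3) + ρ)) = l at *
    apply mul_left_cancel₀ (pow_ne_zero 2 hd.ne')
    linear_combination x * hρ + ((1 + 2 * x) * (1 - x ^ 2) *
      (l * ((1 + 3 * x - x ^ 2 - x ^ 3) + ρ) + 2 * x) -
      (1 + 3 * x - x ^ 2 - x ^ 3) * ((1 + 3 * x - x ^ 2 - x ^ 3) + ρ)) * hld

/-- The second-moment conditions define `a` and `b`. With these values, `1-l` times the first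
contact equation plus `l` times the second holds identically, so both reduce to the one quadratic
satisfied by `lownerHeight (1 / n)`. -/
theorem exists_lowner_axes {n : ℕ} (hn : 1 ≤ n) :
    ∃ a b : ℝ, 0 < a ∧ 0 < b ∧
      n * a ^ 2 = (n + 1) * (1 - lownerHeight (1 / n) + lownerHeight (1 / n) / n ^ 2) ∧
      b ^ 2 = (n + 1) * (lownerHeight (1 / n) * (1 - lownerHeight (1 / n))) ∧
      (lownerHeight (1 / n) / b) ^ 2 + (1 / a) ^ 2 = 1 ∧
      ((1 - lownerHeight (1 / n)) / b) ^ 2 + (1 / (n * a)) ^ 2 = 1 := by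
  have hn0 : (0 : ℝ) < n := by positivity
  have hn1 : (1 : ℝ) ≤ n := by exact_mod_cast hn
  obtain ⟨h0, h1, hroot⟩ := lownerHeight_spec (x := 1 / (n : ℝ)) (by positivity)
    (by rw [div_le_one hn0]; exact hn1)
  generalize lownerHeight (1 / n) = l at *
  have hl1 : 0 < 1 - l := by linarith
  have hc : 0 < 1 - l + l / n ^ 2 := by positivity
  have ha : 0 < (n + 1) / n * (1 - l + l / n ^ 2) := by positivity
  have hb : 0 < (n + 1) * (l * (1 - l)) := by positivity
  field_simp at hroot
  refine ⟨_, _, Real.sqrt_pos.mpr ha, Real.sqrt_pos.mpr hb, ?_, Real.sq_sqrt hb.le, ?_, ?_⟩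
  · rw [Real.sq_sqrt ha.le]
    field_simp
  · rw [div_pow, div_pow, Real.sq_sqrt ha.le, Real.sq_sqrt hb.le]
    have hc' : n ^ 2 * (1 - l) + l ≠ 0 := by positivity
    field_simp
    linear_combination -hroot
  · rw [div_pow, div_pow, mul_pow, Real.sq_sqrt ha.le, Real.sq_sqrt hb.le]
    have hc' : n ^ 2 * (1 - l) + l ≠ 0 := by positivity
    field_simp
    linear_combination hroot

theorem isLittleO_lownerHeight :
    (fun n : ℕ => lownerHeight (1 / n) - 1 / (n : ℝ)) =o[atTop] fun n : ℕ => 1 / (n : ℝ) := by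
  -- At `x = 0` the denominator is `1 + √1 = 2`, so the ratio `lownerHeight x / x` tends to `1`.
  have hcont : Tendsto (fun x : ℝ => 2 / ((1 + 3 * x - x ^ 2 - x ^ 3) +
      √((1 + x - x ^ 2 - x ^ 3) ^ 2 + 4 * x ^ 4)) - 1) (nhds 0) (nhds 0) := by
    have : ContinuousAt (fun x : ℝ => 2 / ((1 + 3 * x - x ^ 2 - x ^ 3) +
        √((1 + x - x ^ 2 - x ^ 3) ^ 2 + 4 * x ^ 4)) - 1) 0 := by
      refine ((continuousAt_const.div ?_ ?_).sub continuousAt_const)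
      · fun_prop
      · norm_num
    have h := this.tendsto
    norm_num at h
    exact h
  have h := hcont.comp (tendsto_one_div_atTop_nhds_zero_nat (𝕜 := ℝ))
  refine (((isLittleO_one_iff ℝ).mpr h).mul_isBigO
    (isBigO_refl (fun n : ℕ => 1 / (n : ℝ)) atTop)).congr (fun n => ?_) fun n => one_mul _
  simp only [lownerHeight, Function.comp]
  ring

theorem mainTheorem9 :
    ∃ l : ℕ → ℝ,
      (fun n : ℕ => l n - 1 / (n : ℝ)) =o[atTop] (fun n : ℕ => 1 / (n : ℝ)) ∧
      ∀ (n : ℕ), 1 ≤ n →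
        ∀ S : Affine.Simplex ℝ (EuclideanSpace ℝ (Fin n)) n, IsInscribedRegularSimplex S →
          (∃! J, IsJohnEllipsoid (bodyM2 S) J) ∧
          (∀ p, IsJohnCenter (bodyM2 S) p ↔
            p = (1 / 2 : ℝ) • EuclideanSpace.single (Fin.last n) (1 : ℝ)) ∧
          (∃! L, IsLownerEllipsoid (bodyM2 S) L) ∧
          (∀ p, IsLownerCenter (bodyM2 S) p ↔
            p = l n • EuclideanSpace.single (Fin.last n) (1 : ℝ)) := by
  refine ⟨fun n => lownerHeight (1 / n), isLittleO_lownerHeight, fun n hn S hS => ?_⟩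
  have hn1 : (1 : ℝ) ≤ n := by exact_mod_cast hn
  have hn0 : (0 : ℝ) < n := by positivity
  obtain ⟨h0, h1, -⟩ := lownerHeight_spec (x := 1 / (n : ℝ)) (by positivity)
    (by rw [div_le_one hn0]; exact hn1)
  obtain ⟨a, b, ha, hb, ha2, hb2, e0, e1⟩ := exists_lowner_axes hn
  simp only [single_last_eq_atHeight, smul_atHeight, smul_zero, mul_one]
  obtain ⟨hJ, hJc⟩ := hS.john_bodyM2 hn
  obtain ⟨hL, hLc⟩ := hS.lowner_bodyM2 hn ha hb h0 h1 ha2 hb2 e0 e1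
  exact ⟨hJ, hJc, hL, hLc⟩
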